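/- **Setting.** For integers $a,b\ge 0$ put $B(a,b)=\{(a+b+1)\binom{a+b}{a}\}^{-1}=\int_0^1 w^a(1-w)^b\,dw$. A vector $\mathbf u=(u_1,\dots,u_m)$ of split points in $[0,1]$ divides $[0,1]$ into $m+1$ intervals $J_0(\mathbf u),\dots,J_m(\mathbf u)$. For a data set $(\mathbf x,\mathbf y)$ with covariates $x_k\in[0,1]$ and responses $y_k\in\{0,1\}$, let $N_i^S$ and $N_i^F$ be the numbers of $k$ with $x_k\in J_i(\mathbf u)$ and $y_k=1$, respectively $y_k=0$. The predictive probabilities and the Poissonized predictive probabilities are $$Z_m(\mathbf x,\mathbf y)=\int_{[0,1]^m}\prod_{i=0}^m B(N_i^S,N_i^F)\,d\mathbf u,\qquad Z^*_\lambda(\mathbf x,\mathbf y)=\sum_{k=0}^\infty\frac{\lambda^k e^{-\lambda}}{k!}Z_k(\mathbf x,\mathbf y).$$ Let $X_1,X_2,\dots$ be i.i.d. uniform on $[0,1]$, and let $\Lambda$ be a Poisson process of intensity $1$ independent of them. Write $(\mathbf X,\mathbf y)_N$ for the data set $(X_1,y_1),\dots,(X_N,y_N)$. **Lemma.** For every $\delta>0$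 there exists $\alpha_\delta<\infty$ such that $$\lim_{n\to\infty}P\Big\{\sup_{\alpha\ge\alpha_\delta}\sup_{\mathbf y}Z^*_{\alpha n}((\mathbf X,\mathbf y)_{\Lambda(n)})\ge 2^{-n+n\delta}\Big\}=0,\qquad \lim_{n\to\infty}P\Big\{\inf_{\alpha\ge\alpha_\delta}\inf_{\mathbf y}Z^*_{\alpha n}((\mathbf X,\mathbf y)_{\Lambda(n)})\le 2^{-n-n\delta}\Big\}=0,$$ $$\lim_{n\to\infty}P\Big\{\sup_{m\ge\alpha_\delta n}\sup_{\mathbf y}Z_m((\mathbf X,\mathbf y)_n)\ge 2^{-n+n\delta}\Big\}=0,\qquad \lim_{n\to\infty}P\Big\{\inf_{m\ge\alpha_\delta n}\inf_{\mathbf y}Z_m((\mathbf X,\mathbf y)_n)\le 2^{-n-n\delta}\Big\}=0,$$ where $\sup_{\mathbf y}$ and $\inf_{\mathbf y}$ run over all assignments of $0$s and $1$s to the responses. **Corollary.** Let $f:[0,1]\to[0,1]$ be Borel measurable, and let $(X_i,Y_i)$ be i.i.d. with $X_i$ uniform on $[0,1]$ and $Y_i$, given $X_i=x$, Bernoulli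 with mean $f(x)$, independent of $\Lambda$. For $\alpha>0$ put $\zeta_n(\alpha)=n^{-1}\log Z^*_{\alpha n}((\mathbf X,\mathbf Y)_{\Lambda(n)})$. If $\zeta_n(\alpha)$ converges in probability, as $n\to\infty$, to a constant $\psi_f(\alpha)$ for each $\alpha>0$, then $$\lim_{\alpha\to\infty}\psi_f(\alpha)=-\log 2.$$ Moreover, without presupposing that these limits exist, the upper and lower limits in probability $$\psi_f^+(\alpha)=\inf\{c: P(\zeta_n(\alpha)>c)\to 0\},\qquad \psi_f^-(\alpha)=\sup\{c: P(\zeta_n(\alpha)<c)\to 0\}$$ both tend to $-\log 2$ as $\alpha\to\infty$ (both equal $\psi_f(\alpha)$ whenever $\zeta_n(\alpha)$ converges in probability to $\psi_f(\alpha)$). -/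

import Mathlib

open MeasureTheory ProbabilityTheory Filter Topology
open scoped NNReal ENNReal unitInterval

namespace BinaryRegression

noncomputable section

/-! ### Predictive probabilities -/

/-- `B(a, b) = ((a + b + 1) * choose (a + b) a)⁻¹`, i.e. `∫₀¹ w ^ a * (1 - w) ^ b dw`. -/
def betaB (a b : ℕ) : ℝ :=
  (((a + b + 1 : ℕ) : ℝ) * ((a + b).choose a : ℝ))⁻¹

/-- The `i`-th cell (from the left) of the partition of `[0, 1]` induced by a vector `u` of `m`
(not necessarily ordered) split points: the points with exactly `i` split points weakly to their
left. If split points coincide, some of the `m + 1` cells are empty. -/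
def cell {m : ℕ} (u : Fin m → I) (i : Fin (m + 1)) : Set I :=
  {x | (Finset.univ.filter fun j => u j ≤ x).card = (i : ℕ)}

open Classical in
/-- The number of successes (`y k = true`) with covariate in `J`. -/
def successes {n : ℕ} (x : Fin n → I) (y : Fin n → Bool) (J : Set I) : ℕ :=
  (Finset.univ.filter fun k => x k ∈ J ∧ y k = true).card

open Classical in
/-- The number of failures (`y k = false`) with covariate in `J`. -/
def failures {n : ℕ} (x : Fin n → I) (y : Fin n → Bool) (J : Set I) : ℕ :=
  (Finset.univ.filter fun k => x k ∈ J ∧ y k = false).card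

/-- The predictive probability of the data set `(x, y)` for the split point vector `u`. -/
def Zsplit {m n : ℕ} (u : Fin m → I) (x : Fin n → I) (y : Fin n → Bool) : ℝ :=
  ∏ i : Fin (m + 1), betaB (successes x y (cell u i)) (failures x y (cell u i))

/-- The predictive probability `Z_m` of the data set `(x, y)`: the uniform mixture of `Zsplit` over
all split point vectors in `[0, 1]^m`. -/
def Z (m : ℕ) {n : ℕ} (x : Fin n → I) (y : Fin n → Bool) : ℝ :=
  ∫ u : Fin m → I, Zsplit u x y

/-- The Poissonized predictive probability `Z*_lam`: the Poisson-`lam` mixture of the `Z_k`. -/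
def Zstar (lam : ℝ) {n : ℕ} (x : Fin n → I) (y : Fin n → Bool) : ℝ :=
  ∑' k : ℕ, lam ^ k * Real.exp (-lam) / (k.factorial : ℝ) * Z k x y

/-! ### The data stream and the Poisson process -/

section Stochastic

variable {Ω : Type*} [MeasurableSpace Ω]

/-- The covariates `X 0, X 1, …` are i.i.d. and uniformly distributed on `[0, 1]`. -/
structure IsUniformSample (P : Measure Ω) (X : ℕ → Ω → I) : Prop where
  indep : iIndepFun X P
  law : ∀ i, HasLaw (X i) volume P

/-- `(X i, Y i)` is a data stream with regression function `f`: the pairs are i.i.d., `X i` is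
uniform on `[0, 1]`, and given `X i = x` the response `Y i` is Bernoulli with mean `f x`. -/
structure IsDataStream (f : I → I) (P : Measure Ω) (X : ℕ → Ω → I) (Y : ℕ → Ω → Bool) :
    Prop where
  measurable_X : ∀ i, Measurable (X i)
  measurable_Y : ∀ i, Measurable (Y i)
  indep : iIndepFun (fun i ω => (X i ω, Y i ω)) P
  law : ∀ i, HasLaw (X i) volume P
  condExp : ∀ i,
    P[fun ω => if Y i ω = true then (1 : ℝ) else 0 | MeasurableSpace.comap (X i) inferInstance]
      =ᵐ[P] fun ω => (f (X i ω) : ℝ)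

/-- A Poisson counting process of intensity `1`. -/
structure IsPoissonProcess (P : Measure Ω) (L : ℝ≥0 → Ω → ℕ) : Prop where
  paths : ∀ᵐ ω ∂P, L 0 ω = 0 ∧ Monotone (fun t => L t ω) ∧
    ∀ t, ContinuousWithinAt (fun s => L s ω) (Set.Ici t) t
  indepIncrements : HasIndepIncrements L P
  law : ∀ s t : ℝ≥0, s ≤ t → HasLaw (fun ω => L t ω - L s ω) (poissonMeasure (t - s)) P

/-- The first `n` terms of a sequence of random variables, evaluated at `ω`. -/
def sample {β : Type*} (V : ℕ → Ω → β) (n : ℕ) (ω : Ω) : Fin n → β :=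
  fun k => V k ω

/-- `n⁻¹ * log Z*_{α n}((X, Y)_{L(n)})`. -/
def logPredictive (X : ℕ → Ω → I) (Y : ℕ → Ω → Bool) (L : ℝ≥0 → Ω → ℕ) (α : ℝ) (n : ℕ)
    (ω : Ω) : ℝ :=
  (n : ℝ)⁻¹ * Real.log (Zstar (α * n) (sample X (L n ω) ω) (sample Y (L n ω) ω))

/-- `c` is the value `ψ_f(α)` of the rate function: the constant to which `logPredictive`
converges in probability as `n → ∞`. -/
def IsRate (P : Measure Ω) (X : ℕ → Ω → I) (Y : ℕ → Ω → Bool) (L : ℝ≥0 → Ω → ℕ)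
    (α c : ℝ) : Prop :=
  TendstoInMeasure P (logPredictive X Y L α) atTop (fun _ => c)

/-- The upper limit in probability of `logPredictive`, which is defined without presupposing that
the limit in probability exists and agrees with it if it does. -/
def upperRate (P : Measure Ω) (X : ℕ → Ω → I) (Y : ℕ → Ω → Bool) (L : ℝ≥0 → Ω → ℕ)
    (α : ℝ) : ℝ :=
  sInf {c : ℝ | Tendsto (fun n : ℕ => P {ω | c < logPredictive X Y L α n ω}) atTop (𝓝 0)}

/-- The lower limit in probability of `logPredictive`, which is defined without presupposing that
the limit in probability exists and agrees with it if it does. -/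
def lowerRate (P : Measure Ω) (X : ℕ → Ω → I) (Y : ℕ → Ω → Bool) (L : ℝ≥0 → Ω → ℕ)
    (α : ℝ) : ℝ :=
  sSup {c : ℝ | Tendsto (fun n : ℕ => P {ω | logPredictive X Y L α n ω < c}) atTop (𝓝 0)}

end Stochastic

end

end BinaryRegression

universe v

open BinaryRegression

/-! A cell holding one point contributes `betaB 1 0 = betaB 0 1 = 1 / 2`, whatever the response, and
an empty cell contributes 1. With far more than n splits most points are alone in their cells, so
the product is about 2^(-n) for every y.

Quantitatively, a cell with N ≥ 1 points contributes between 2^(-(2N-1)) and 2^(-1). Hence `Zsplit`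
lies within a factor `excess` = 2^(n - occupied) of 2^(-n), on either side, and this factor does not
involve y. Its mean over the splits controls `Z` and `Zstar` from above directly, and from below by
convexity of v ↦ 1/v.

To bound the mean (`meanExcess_le_sum`), attach to each separated point the interval of length h on
its right. These intervals are disjoint, and separated points whose interval catches a split lie in
distinct cells. Expanding a product over the missed intervals leaves the probabilities (1 - |S| h)^m
that m splits avoid |S| intervals, which sum to at most (1 + exp(-mh))^n. Poisson mixing only
replaces (1 - |S| h)^m by exp(-lam |S| h).

The number of crowded points has a bounded exponential growth rate (`lintegral_pow_crowded_le`):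
given the earlier points, each new one is crowded with probability O(nh). Take h = c/n with c small,
then α so large that exp(-αc) is small. A random sample size near n is absorbed by monotonicity of
`crowded` in the sample size and Chebyshev's inequality. The rates then lie within any η of -log 2
for large α. -/

namespace BinaryRegression

/-! ### Bounds for a fixed vector of splits. -/

/-- The index of the cell of the partition induced by `u` that contains `z`. -/
noncomputable def label {m : ℕ} (u : Fin m → I) (z : I) : ℕ :=
  (Finset.univ.filter fun j => u j ≤ z).card

/-- The number of cells of the partition induced by `u` that contain a point of `x`. -/
noncomputable def occupied {m n : ℕ} (u : Fin m → I) (x : Fin n → I) : ℕ :=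
  (Finset.univ.image fun k => label u (x k)).card

lemma label_le {m : ℕ} (u : Fin m → I) (z : I) : label u z ≤ m := by
  simpa [label] using Finset.card_filter_le (Finset.univ : Finset (Fin m)) fun j => u j ≤ z

lemma occupied_le {m n : ℕ} (u : Fin m → I) (x : Fin n → I) : occupied u x ≤ n := by
  simpa [occupied] using Finset.card_image_le (s := (Finset.univ : Finset (Fin n)))
    (f := fun k => label u (x k))

lemma betaB_nonneg (a b : ℕ) : 0 ≤ betaB a b := by unfold betaB; positivity

lemma betaB_le_half {a b : ℕ} (h : a + b ≠ 0) : betaB a b ≤ 1 / 2 := by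
  unfold betaB
  rw [one_div]
  apply inv_anti₀ (by norm_num)
  have h1 : (2 : ℝ) ≤ ((a + b + 1 : ℕ) : ℝ) := by exact_mod_cast (by omega)
  have h2 : (1 : ℝ) ≤ ((a + b).choose a : ℝ) := by
    exact_mod_cast Nat.choose_pos (Nat.le_add_right a b)
  nlinarith

/-- By Pascal's rule the coefficient is a sum of two entries of row n, whose total is 2^n. -/
lemma choose_succ_le_two_pow (n k : ℕ) : (n + 1).choose k ≤ 2 ^ n := by
  cases k with
  | zero => simpa using Nat.one_le_two_pow
  | succ k =>
    rw [Nat.choose_succ_succ]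
    have h := Finset.sum_le_sum_of_subset (f := fun i => n.choose i)
      (show ({k, k + 1} : Finset ℕ) ⊆ Finset.range (max (n + 1) (k + 2)) by
        intro i hi
        simp only [Finset.mem_insert, Finset.mem_singleton] at hi
        simp only [Finset.mem_range]
        omega)
    rw [Finset.sum_pair (by omega)] at h
    refine h.trans ?_
    rw [← Nat.sum_range_choose n]
    refine (Finset.sum_subset (Finset.range_subset_range.2 (le_max_left _ _)) ?_).ge
    intro i _ hi
    exact Nat.choose_eq_zero_of_lt (by simp only [Finset.mem_range] at hi; omega)

/-- For N + 1 points, the factor N + 2 is at most 2^(N + 1) and the binomial coefficient at most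
2^N. For an empty cell the truncated exponent is 0, matching `betaB 0 0 = 1`. -/
lemma half_pow_le_betaB (a b : ℕ) : (1 / 2 : ℝ) ^ (2 * (a + b) - 1) ≤ betaB a b := by
  unfold betaB
  rw [one_div, inv_pow]
  apply inv_anti₀
  · have := Nat.choose_pos (Nat.le_add_right a b)
    positivity
  obtain h | ⟨N, hN⟩ : a + b = 0 ∨ ∃ N, a + b = N + 1 := by
    rcases Nat.eq_zero_or_eq_succ_pred (a + b) with h | h
    · exact .inl h
    · exact .inr ⟨_, h⟩
  · obtain ⟨rfl, rfl⟩ : a = 0 ∧ b = 0 := by omega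
    simp
  · rw [hN]
    have h1 : N + 1 + 1 ≤ 2 ^ (N + 1) := Nat.lt_two_pow_self
    have h2 := choose_succ_le_two_pow N a
    have h3 := Nat.mul_le_mul h1 h2
    rw [← pow_add, show N + 1 + N = 2 * (N + 1) - 1 by omega] at h3
    exact_mod_cast h3

/-- The number of points of `x` with label `i`. -/
noncomputable def cellCount {m n : ℕ} (u : Fin m → I) (x : Fin n → I) (i : ℕ) : ℕ :=
  (Finset.univ.filter fun k => label u (x k) = i).card

lemma successes_cell {m n : ℕ} (u : Fin m → I) (x : Fin n → I) (y : Fin n → Bool)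
    (i : Fin (m + 1)) : successes x y (cell u i) =
      (Finset.univ.filter fun k => label u (x k) = i ∧ y k = true).card := by
  classical
  unfold successes
  congr 1
  ext k
  rw [Finset.mem_filter, Finset.mem_filter]
  rfl

lemma failures_cell {m n : ℕ} (u : Fin m → I) (x : Fin n → I) (y : Fin n → Bool)
    (i : Fin (m + 1)) : failures x y (cell u i) =
      (Finset.univ.filter fun k => label u (x k) = i ∧ y k = false).card := by
  classical
  unfold failures
  congr 1
  ext k
  rw [Finset.mem_filter, Finset.mem_filter]
  rfl

lemma successes_add_failures {m n : ℕ} (u : Fin m → I) (x : Fin n → I) (y : Fin n → Bool)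
    (i : Fin (m + 1)) :
    successes x y (cell u i) + failures x y (cell u i) = cellCount u x i := by
  have key := Finset.card_filter_add_card_filter_not
    (s := Finset.univ.filter fun k => label u (x k) = i) (fun k => y k = true)
  rw [Finset.filter_filter, Finset.filter_filter] at key
  rw [cellCount, ← key, successes_cell, failures_cell]
  simp only [Bool.not_eq_true]

lemma cellCount_eq_zero_iff {m n : ℕ} (u : Fin m → I) (x : Fin n → I) (i : ℕ) :
    cellCount u x i = 0 ↔ i ∉ Finset.univ.image fun k => label u (x k) := by
  simp [cellCount, Finset.filter_eq_empty_iff]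

lemma card_occupied_cells {m n : ℕ} (u : Fin m → I) (x : Fin n → I) :
    ((Finset.range (m + 1)).filter fun i => cellCount u x i ≠ 0).card = occupied u x := by
  unfold occupied
  congr 1
  ext i
  simp only [Finset.mem_filter, Finset.mem_range, ne_eq, cellCount_eq_zero_iff, not_not,
    and_iff_right_iff_imp, Finset.mem_image, Finset.mem_univ, true_and]
  rintro ⟨k, rfl⟩
  exact Nat.lt_succ_of_le (label_le _ _)

lemma sum_cellCount {m n : ℕ} (u : Fin m → I) (x : Fin n → I) :
    ∑ i ∈ Finset.range (m + 1), cellCount u x i = n := by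
  have := Finset.card_eq_sum_card_fiberwise (s := (Finset.univ : Finset (Fin n)))
    (t := Finset.range (m + 1)) (f := fun k => label u (x k))
    (fun k _ => by simpa using Nat.lt_succ_of_le (label_le u (x k)))
  simpa [cellCount] using this.symm

lemma Zsplit_nonneg {m n : ℕ} (u : Fin m → I) (x : Fin n → I) (y : Fin n → Bool) :
    0 ≤ Zsplit u x y := Finset.prod_nonneg fun _ _ => betaB_nonneg _ _

lemma Zsplit_le_half_pow {m n : ℕ} (u : Fin m → I) (x : Fin n → I) (y : Fin n → Bool) :
    Zsplit u x y ≤ (1 / 2 : ℝ) ^ occupied u x := by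
  calc Zsplit u x y
      ≤ ∏ i : Fin (m + 1), if cellCount u x i ≠ 0 then (1 / 2 : ℝ) else 1 := by
        refine Finset.prod_le_prod (fun _ _ => betaB_nonneg _ _) fun i _ => ?_
        have h := successes_add_failures u x y i
        split_ifs with hi
        · exact betaB_le_half (by omega)
        · obtain ⟨h1, h2⟩ : successes x y (cell u i) = 0 ∧ failures x y (cell u i) = 0 := by omega
          simp [h1, h2, betaB]
    _ = ∏ i ∈ Finset.range (m + 1), if cellCount u x i ≠ 0 then (1 / 2 : ℝ) else 1 :=
        Fin.prod_univ_eq_prod_range (fun i => if cellCount u x i ≠ 0 then (1 / 2 : ℝ) else 1) _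
    _ = (1 / 2 : ℝ) ^ occupied u x := by
        rw [← Finset.prod_filter, Finset.prod_const, card_occupied_cells]

lemma half_pow_le_Zsplit {m n : ℕ} (u : Fin m → I) (x : Fin n → I) (y : Fin n → Bool) :
    (1 / 2 : ℝ) ^ (2 * n - occupied u x) ≤ Zsplit u x y := by
  calc (1 / 2 : ℝ) ^ (2 * n - occupied u x)
      = ∏ i ∈ Finset.range (m + 1), (1 / 2 : ℝ) ^ (2 * cellCount u x i - 1) := by
        rw [Finset.prod_pow_eq_pow_sum]
        congr 1
        -- Truncated subtraction removes 1 only at occupied cells, so the exponents add up to 2n -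
        -- occupied.
        have h : ∑ i ∈ Finset.range (m + 1), (2 * cellCount u x i - 1) +
            ∑ i ∈ Finset.range (m + 1), (if cellCount u x i ≠ 0 then 1 else 0) =
            ∑ i ∈ Finset.range (m + 1), 2 * cellCount u x i := by
          rw [← Finset.sum_add_distrib]
          refine Finset.sum_congr rfl fun i _ => ?_
          split_ifs <;> omega
        rw [← Finset.card_filter, card_occupied_cells, ← Finset.mul_sum, sum_cellCount] at h
        omega
    _ = ∏ i : Fin (m + 1), (1 / 2 : ℝ) ^ (2 * cellCount u x i - 1) :=
        (Fin.prod_univ_eq_prod_range (fun i => (1 / 2 : ℝ) ^ (2 * cellCount u x i - 1)) _).symm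
    _ ≤ Zsplit u x y := by
        refine Finset.prod_le_prod (fun _ _ => by positivity) fun i _ => ?_
        rw [← successes_add_failures u x y i]
        exact half_pow_le_betaB _ _

/-! ### Measurability and averaging over the splits. -/

/-- The splits enter only through the labels, which take values in a discrete countable space, so no
condition on `Φ` is needed. -/
lemma measurable_comp_label {m n : ℕ} (x : Fin n → I) (Φ : (Fin n → ℕ) → ℝ) :
    Measurable fun u : Fin m → I => Φ fun k => label u (x k) := by
  refine (Measurable.of_discrete (f := Φ)).comp (measurable_pi_lambda _ fun k => ?_)
  unfold label
  simp_rw [Finset.card_filter]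
  refine Finset.measurable_sum _ fun j _ => ?_
  exact Measurable.ite (measurableSet_le (measurable_pi_apply j) measurable_const)
    measurable_const measurable_const

lemma measurable_Zsplit {m n : ℕ} (x : Fin n → I) (y : Fin n → Bool) :
    Measurable fun u : Fin m → I => Zsplit u x y := by
  simp only [Zsplit, successes_cell, failures_cell]
  exact measurable_comp_label x fun c => ∏ i : Fin (m + 1),
    betaB (Finset.univ.filter fun k => c k = i ∧ y k = true).card
      (Finset.univ.filter fun k => c k = i ∧ y k = false).card

/-- The factor by which the predictive probability for the splits `u` may differ from `2 ^ (-n)`. -/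
noncomputable def excess {m n : ℕ} (u : Fin m → I) (x : Fin n → I) : ℝ :=
  2 ^ (n - occupied u x)

lemma measurable_excess {m n : ℕ} (x : Fin n → I) :
    Measurable fun u : Fin m → I => excess u x :=
  measurable_comp_label x fun c => (2 : ℝ) ^ (n - (Finset.univ.image c).card)

lemma excess_pos {m n : ℕ} (u : Fin m → I) (x : Fin n → I) : 0 < excess u x := by
  unfold excess; positivity

lemma excess_le {m n : ℕ} (u : Fin m → I) (x : Fin n → I) : excess u x ≤ 2 ^ n :=
  pow_le_pow_right₀ (by norm_num) (Nat.sub_le _ _)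

lemma integrable_excess {m n : ℕ} (x : Fin n → I) :
    Integrable fun u : Fin m → I => excess u x :=
  Integrable.of_bound (measurable_excess x).aestronglyMeasurable (2 ^ n)
    (ae_of_all _ fun u => by
      rw [Real.norm_of_nonneg (excess_pos u x).le]; exact excess_le u x)

lemma Zsplit_le_one {m n : ℕ} (u : Fin m → I) (x : Fin n → I) (y : Fin n → Bool) :
    Zsplit u x y ≤ 1 :=
  (Zsplit_le_half_pow u x y).trans (pow_le_one₀ (by norm_num) (by norm_num))

lemma integrable_Zsplit {m n : ℕ} (x : Fin n → I) (y : Fin n → Bool) :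
    Integrable fun u : Fin m → I => Zsplit u x y :=
  Integrable.of_bound (measurable_Zsplit x y).aestronglyMeasurable 1
    (ae_of_all _ fun u => by
      rw [Real.norm_of_nonneg (Zsplit_nonneg u x y)]; exact Zsplit_le_one u x y)

lemma Zsplit_le_excess {m n : ℕ} (u : Fin m → I) (x : Fin n → I) (y : Fin n → Bool) :
    Zsplit u x y ≤ (1 / 2) ^ n * excess u x := by
  refine (Zsplit_le_half_pow u x y).trans_eq ?_
  obtain ⟨d, hd⟩ := Nat.exists_eq_add_of_le (occupied_le u x)
  rw [excess, show n - occupied u x = d by omega]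
  conv_rhs => rw [hd, pow_add, mul_assoc, ← mul_pow]
  norm_num

lemma excess_inv_le_Zsplit {m n : ℕ} (u : Fin m → I) (x : Fin n → I) (y : Fin n → Bool) :
    (1 / 2) ^ n * (excess u x)⁻¹ ≤ Zsplit u x y := by
  refine le_trans (le_of_eq ?_) (half_pow_le_Zsplit u x y)
  have := occupied_le u x
  rw [excess, ← inv_pow, ← one_div, ← pow_add]
  congr 1
  omega

/-- The tangent of v ↦ 1/v at M. Being affine in v, this minorant passes through both the integral
over splits and the Poisson sum, and so replaces Jensen's inequality. -/
lemma tangent_le_inv {v M : ℝ} (hv : 0 < v) (hM : 0 < M) : 2 / M - v / M ^ 2 ≤ v⁻¹ := by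
  have h : v⁻¹ - (2 / M - v / M ^ 2) = (v - M) ^ 2 / (v * M ^ 2) := by field_simp; ring
  have : 0 ≤ (v - M) ^ 2 / (v * M ^ 2) := by positivity
  linarith

/-- The mean of `excess` over uniform split points. -/
noncomputable def meanExcess (m : ℕ) {n : ℕ} (x : Fin n → I) : ℝ :=
  ∫ u : Fin m → I, excess u x

lemma Z_nonneg (m : ℕ) {n : ℕ} (x : Fin n → I) (y : Fin n → Bool) : 0 ≤ Z m x y :=
  integral_nonneg fun u => Zsplit_nonneg u x y

lemma Z_le_one (m : ℕ) {n : ℕ} (x : Fin n → I) (y : Fin n → Bool) : Z m x y ≤ 1 := by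
  have h : Z m x y ≤ ∫ _ : Fin m → I, (1 : ℝ) :=
    integral_mono (integrable_Zsplit x y) (integrable_const _) fun u => Zsplit_le_one u x y
  simpa using h

lemma Z_le_meanExcess (m : ℕ) {n : ℕ} (x : Fin n → I) (y : Fin n → Bool) :
    Z m x y ≤ (1 / 2) ^ n * meanExcess m x := by
  rw [meanExcess, ← integral_const_mul]
  exact integral_mono (integrable_Zsplit x y) ((integrable_excess x).const_mul _)
    fun u => Zsplit_le_excess u x y

lemma tangent_le_Z (m : ℕ) {n : ℕ} (x : Fin n → I) (y : Fin n → Bool) {M : ℝ} (hM : 0 < M) :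
    (1 / 2) ^ n * (2 / M - meanExcess m x / M ^ 2) ≤ Z m x y := by
  have h : ∫ u : Fin m → I, (1 / 2 : ℝ) ^ n * (2 / M - excess u x / M ^ 2) ≤ Z m x y := by
    refine integral_mono (((integrable_const _).sub ((integrable_excess x).div_const _)).const_mul _)
      (integrable_Zsplit x y) fun u => ?_
    exact (mul_le_mul_of_nonneg_left (tangent_le_inv (excess_pos u x) hM) (by positivity)).trans
      (excess_inv_le_Zsplit u x y)
  rw [integral_const_mul, integral_sub (integrable_const _) ((integrable_excess x).div_const _)] at h
  rw [meanExcess, ← integral_div]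
  simpa using h

/-! ### Separated points and the mean excess. -/

/-- The indices of the points of `x` which have no earlier point and not the point `1` within
distance `h`. -/
noncomputable def separated {n : ℕ} (h : ℝ) (x : Fin n → I) : Finset (Fin n) :=
  Finset.univ.filter fun k => (x k : ℝ) + h ≤ 1 ∧ ∀ l < k, h < |(x k : ℝ) - x l|

/-- The interval of length `h` to the right of `z`. -/
def rightInterval (h : ℝ) (z : I) : Set I := {w | (z : ℝ) < w ∧ (w : ℝ) ≤ z + h}

/-- Membership compares a point with earlier indices only, but of two members one is the earlier. -/
lemma lt_abs_sub_of_mem_separated {n : ℕ} {h : ℝ} {x : Fin n → I} {k l : Fin n}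
    (hk : k ∈ separated h x) (hl : l ∈ separated h x) (hkl : k ≠ l) :
    h < |(x k : ℝ) - x l| := by
  simp only [separated, Finset.mem_filter, Finset.mem_univ, true_and] at hk hl
  rcases lt_or_gt_of_ne hkl with h' | h'
  · rw [abs_sub_comm]; exact hl.2 k h'
  · exact hk.2 l h'

lemma label_lt_label {m : ℕ} {u : Fin m → I} {z w : I} {h : ℝ} {j : Fin m}
    (hj : u j ∈ rightInterval h z) (hzw : (z : ℝ) + h < w) : label u z < label u w := by
  refine Finset.card_lt_card ((Finset.ssubset_iff_of_subset ?_).2 ⟨j, ?_, ?_⟩)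
  · intro i hi
    simp only [Finset.mem_filter, Finset.mem_univ, true_and] at hi ⊢
    have : (u i : ℝ) ≤ z := hi
    have h1 := hj.1
    have h2 := hj.2
    exact Subtype.coe_le_coe.1 (by linarith)
  · simp only [Finset.mem_filter, Finset.mem_univ, true_and]
    exact Subtype.coe_le_coe.1 (by linarith [hj.2])
  · simp only [Finset.mem_filter, Finset.mem_univ, true_and, not_le]
    exact Subtype.coe_lt_coe.1 hj.1

-- Separated points whose right interval is hit have distinct labels, so they number at most
-- `occupied u x`. The exponent n - occupied is thus at most the number of non-separated points plus
-- the number of missed intervals.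
open Classical in
lemma excess_le_prod {m n : ℕ} (u : Fin m → I) (x : Fin n → I) {h : ℝ} :
    excess u x ≤ 2 ^ (n - (separated h x).card) *
      ∏ k ∈ separated h x, (1 + if ∀ j, u j ∉ rightInterval h (x k) then (1 : ℝ) else 0) := by
  set G := separated h x
  have hinj : Set.InjOn (fun k => label u (x k))
      (G.filter fun k => ¬ ∀ j, u j ∉ rightInterval h (x k) : Finset (Fin n)) := by
    have aux : ∀ k ∈ G, ∀ l ∈ G, k ≠ l → (∃ j, u j ∈ rightInterval h (x k)) → x k ≤ x l →
        label u (x k) < label u (x l) := by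
      rintro k hk l hl hkl ⟨j, hj⟩ hle
      have h1 := lt_abs_sub_of_mem_separated hk hl hkl
      have h2 : (x k : ℝ) ≤ x l := hle
      rw [abs_sub_comm, abs_of_nonneg (by linarith)] at h1
      exact label_lt_label hj (by linarith)
    intro k hk l hl hkl
    simp only [Finset.coe_filter, Set.mem_ofPred_eq, not_forall, not_not] at hk hl
    by_contra hne
    simp only at hkl
    rcases le_total (x k) (x l) with hle | hle
    · exact (aux k hk.1 l hl.1 hne hk.2 hle).ne hkl
    · exact (aux l hl.1 k hk.1 (Ne.symm hne) hl.2 hle).ne hkl.symm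
  have hcard : (G.filter fun k => ¬ ∀ j, u j ∉ rightInterval h (x k)).card ≤ occupied u x := by
    rw [← Finset.card_image_of_injOn hinj]
    exact Finset.card_le_card (Finset.image_subset_image (Finset.subset_univ _))
  have hsplit := Finset.card_filter_add_card_filter_not (s := G)
    (fun k => ∀ j, u j ∉ rightInterval h (x k))
  have hprod : ∏ k ∈ G, (1 + if ∀ j, u j ∉ rightInterval h (x k) then (1 : ℝ) else 0) =
      2 ^ (G.filter fun k => ∀ j, u j ∉ rightInterval h (x k)).card := by
    rw [← Finset.prod_const, Finset.prod_filter]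
    refine Finset.prod_congr rfl fun k _ => ?_
    split_ifs <;> norm_num
  have hG : G.card ≤ n := by simpa using Finset.card_le_univ G
  rw [hprod, ← pow_add, excess]
  exact pow_le_pow_right₀ (by norm_num) (by omega)

lemma measurableSet_rightInterval (h : ℝ) (z : I) : MeasurableSet (rightInterval h z) :=
  (measurableSet_lt measurable_const measurable_subtype_coe).inter
    (measurableSet_le measurable_subtype_coe measurable_const)

lemma volume_real_rightInterval {h : ℝ} (h0 : 0 ≤ h) {z : I} (hz : (z : ℝ) + h ≤ 1) :
    (volume : Measure I).real (rightInterval h z) = h := by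
  have : rightInterval h z = Set.Ioc z ⟨z + h, add_nonneg z.2.1 h0, hz⟩ := by
    ext w
    simp [rightInterval, ← Subtype.coe_le_coe, ← Subtype.coe_lt_coe]
  rw [this, measureReal_def, unitInterval.volume_Ioc]
  simp [h0]

/-- The splits are independent and the intervals are disjoint, of total length |S| h; the condition
x + h ≤ 1 keeps each one inside the unit interval. -/
lemma volume_real_avoid {m n : ℕ} (x : Fin n → I) {h : ℝ} (h0 : 0 ≤ h) {S : Finset (Fin n)}
    (hS : S ⊆ separated h x) :
    (volume : Measure (Fin m → I)).real
      {u | ∀ k ∈ S, ∀ j, u j ∉ rightInterval h (x k)} = (1 - S.card * h) ^ m := by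
  have hset : {u : Fin m → I | ∀ k ∈ S, ∀ j, u j ∉ rightInterval h (x k)} =
      Set.univ.pi fun _ => (⋃ k ∈ S, rightInterval h (x k))ᶜ := by
    ext u
    simp only [Set.mem_ofPred_eq, Set.mem_univ_pi, Set.mem_compl_iff, Set.mem_iUnion, not_exists]
    exact ⟨fun H j k hk => H k hk j, fun H k hk j => H j k hk⟩
  have hdisj : (S : Set (Fin n)).PairwiseDisjoint fun k => rightInterval h (x k) := by
    intro k hk l hl hkl
    refine Set.disjoint_left.2 fun z hz1 hz2 => ?_
    have := lt_abs_sub_of_mem_separated (hS hk) (hS hl) hkl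
    rcases abs_cases ((x k : ℝ) - x l) with h' | h' <;> linarith [hz1.1, hz1.2, hz2.1, hz2.2]
  have hvol : (volume : Measure I).real (⋃ k ∈ S, rightInterval h (x k)) = S.card * h := by
    rw [measureReal_biUnion_finset hdisj fun k _ => measurableSet_rightInterval _ _]
    rw [Finset.sum_congr rfl fun k hk => volume_real_rightInterval h0 ?_]
    · simp
    · have := hS hk
      simp only [separated, Finset.mem_filter] at this
      exact this.2.1
  have hmeas : MeasurableSet (⋃ k ∈ S, rightInterval h (x k)) :=
    S.measurableSet_biUnion fun k _ => measurableSet_rightInterval _ _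
  rw [hset, measureReal_def, volume_pi_pi, ENNReal.toReal_prod]
  simp only [← measureReal_def, probReal_compl_eq_one_sub hmeas, hvol]
  simp

/-- Nonnegativity of the avoidance probability for a single split. It makes 1 - |S| h nonnegative,
as raising 1 - t ≤ exp(-t) to a power requires. -/
lemma card_mul_le_one {n : ℕ} (x : Fin n → I) {h : ℝ} (h0 : 0 ≤ h) {S : Finset (Fin n)}
    (hS : S ⊆ separated h x) : S.card * h ≤ 1 := by
  have := volume_real_avoid (m := 1) x h0 hS
  have h1 : 0 ≤ (volume : Measure (Fin 1 → I)).real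
      {u | ∀ k ∈ S, ∀ j, u j ∉ rightInterval h (x k)} := measureReal_nonneg
  rw [this, pow_one] at h1
  linarith

lemma meanExcess_le_sum (m : ℕ) {n : ℕ} (x : Fin n → I) {h : ℝ} (h0 : 0 ≤ h) :
    meanExcess m x ≤ 2 ^ (n - (separated h x).card) *
      ∑ S ∈ (separated h x).powerset, (1 - S.card * h) ^ m := by
  classical
  have hmeas : ∀ S : Finset (Fin n), MeasurableSet
      {u : Fin m → I | ∀ k ∈ S, ∀ j, u j ∉ rightInterval h (x k)} := by
    intro S
    simp only [Set.ofPred_forall]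
    refine S.measurableSet_biInter fun k _ => MeasurableSet.iInter fun j => ?_
    exact (measurableSet_rightInterval h (x k)).compl.preimage (measurable_pi_apply j)
  have hint : ∀ S : Finset (Fin n), Integrable
      ({u : Fin m → I | ∀ k ∈ S, ∀ j, u j ∉ rightInterval h (x k)}.indicator
        fun _ => (1 : ℝ)) :=
    fun S => (integrable_const _).indicator (hmeas S)
  have hle : ∀ u : Fin m → I, excess u x ≤ 2 ^ (n - (separated h x).card) *
      ∑ S ∈ (separated h x).powerset,
        {u : Fin m → I | ∀ k ∈ S, ∀ j, u j ∉ rightInterval h (x k)}.indicator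
          (fun _ => (1 : ℝ)) u := by
    intro u
    refine (excess_le_prod u x (h := h)).trans_eq ?_
    rw [Finset.prod_one_add]
    congr 1
    refine Finset.sum_congr rfl fun S _ => ?_
    rw [Finset.prod_ite_zero]
    simp [Set.indicator_apply]
  calc meanExcess m x
      ≤ ∫ u : Fin m → I, 2 ^ (n - (separated h x).card) *
      ∑ S ∈ (separated h x).powerset,
        {u : Fin m → I | ∀ k ∈ S, ∀ j, u j ∉ rightInterval h (x k)}.indicator
          (fun _ => (1 : ℝ)) u :=
        integral_mono (integrable_excess x)
          ((integrable_finsetSum _ fun S _ => hint S).const_mul _) hle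
    _ = _ := by
        rw [integral_const_mul, integral_finsetSum _ fun S _ => hint S]
        congr 1
        refine Finset.sum_congr rfl fun S hS => ?_
        rw [integral_indicator_const _ (hmeas S), volume_real_avoid x h0 (Finset.mem_powerset.1 hS)]
        simp

lemma sum_powerset_pow_le {n : ℕ} (G : Finset (Fin n)) {t : ℝ} (ht : 0 ≤ t) :
    ∑ S ∈ G.powerset, t ^ S.card ≤ (1 + t) ^ n := by
  have h1 : ∑ S ∈ G.powerset, t ^ S.card = (t + 1) ^ G.card := by
    rw [← Finset.sum_pow_mul_eq_add_pow]
    simp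
  rw [h1, add_comm]
  exact pow_le_pow_right₀ (by linarith) (by simpa using Finset.card_le_univ G)

/-- The common bound on the mean excess for at least `lam` split points. -/
noncomputable def excessBound (h lam : ℝ) {n : ℕ} (x : Fin n → I) : ℝ :=
  2 ^ (n - (separated h x).card) * (1 + Real.exp (-(lam * h))) ^ n

lemma excessBound_pos (h lam : ℝ) {n : ℕ} (x : Fin n → I) : 0 < excessBound h lam x := by
  unfold excessBound; positivity

lemma meanExcess_le {m n : ℕ} (x : Fin n → I) {h lam : ℝ} (h0 : 0 ≤ h) (hm : lam ≤ m) :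
    meanExcess m x ≤ excessBound h lam x := by
  refine (meanExcess_le_sum m x h0).trans ?_
  refine mul_le_mul_of_nonneg_left ?_ (by positivity)
  refine le_trans (Finset.sum_le_sum fun S hS => ?_)
    (sum_powerset_pow_le (separated h x) (Real.exp_pos _).le)
  have h1 := card_mul_le_one x h0 (Finset.mem_powerset.1 hS)
  calc (1 - (S.card : ℝ) * h) ^ m ≤ (Real.exp (-(S.card * h))) ^ m :=
        pow_le_pow_left₀ (by linarith) (Real.one_sub_le_exp_neg _) _
    _ ≤ Real.exp (-(lam * h)) ^ S.card := by
        rw [← Real.exp_nat_mul, ← Real.exp_nat_mul, Real.exp_le_exp]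
        have : 0 ≤ (S.card : ℝ) * h := by positivity
        nlinarith

/-! ### Poisson mixtures and two-sided bounds. -/

/-- The Poisson weights sum to `1`, and their generating function is `exp (-lam * (1 - q))`. -/
lemma hasSum_poisson_mul_pow (lam q : ℝ) :
    HasSum (fun k : ℕ => lam ^ k * Real.exp (-lam) / (k.factorial : ℝ) * q ^ k)
      (Real.exp (-(lam * (1 - q)))) := by
  have h := (NormedSpace.expSeries_div_hasSum_exp (lam * q)).mul_left (Real.exp (-lam))
  rw [← Real.exp_eq_exp_ℝ, ← Real.exp_add] at h
  convert! h using 1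
  · ext k
    rw [mul_pow]; ring
  · congr 1; ring

lemma hasSum_poisson (lam : ℝ) :
    HasSum (fun k : ℕ => lam ^ k * Real.exp (-lam) / (k.factorial : ℝ)) 1 := by
  simpa using hasSum_poisson_mul_pow lam 1

lemma summable_poisson_mul {lam : ℝ} (hlam : 0 ≤ lam) {f : ℕ → ℝ} {C : ℝ} (hf : ∀ k, |f k| ≤ C) :
    Summable fun k : ℕ => lam ^ k * Real.exp (-lam) / (k.factorial : ℝ) * f k := by
  refine Summable.of_norm_bounded ((hasSum_poisson lam).summable.mul_right C) fun k => ?_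
  have : 0 ≤ lam ^ k * Real.exp (-lam) / (k.factorial : ℝ) := by positivity
  rw [Real.norm_eq_abs, abs_mul, abs_of_nonneg this]
  exact mul_le_mul_of_nonneg_left (hf k) this

lemma meanExcess_nonneg (m : ℕ) {n : ℕ} (x : Fin n → I) : 0 ≤ meanExcess m x :=
  integral_nonneg fun u => (excess_pos u x).le

lemma abs_meanExcess_le (m : ℕ) {n : ℕ} (x : Fin n → I) : |meanExcess m x| ≤ 2 ^ n := by
  rw [abs_of_nonneg (meanExcess_nonneg m x)]
  have h : meanExcess m x ≤ ∫ _ : Fin m → I, (2 ^ n : ℝ) :=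
    integral_mono (integrable_excess x) (integrable_const _) fun u => excess_le u x
  simpa using h

lemma abs_Z_le (m : ℕ) {n : ℕ} (x : Fin n → I) (y : Fin n → Bool) : |Z m x y| ≤ 1 := by
  rw [abs_of_nonneg (Z_nonneg m x y)]; exact Z_le_one m x y

/-- The generating function at q = 1 - |S| h turns each avoidance probability into exp(-lam' |S| h),
which decreases in lam'; this gives uniformity over all larger rates. -/
lemma tsum_meanExcess_le {n : ℕ} (x : Fin n → I) {h lam lam' : ℝ} (h0 : 0 ≤ h) (hlam : 0 ≤ lam)
    (hle : lam ≤ lam') :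
    ∑' k : ℕ, lam' ^ k * Real.exp (-lam') / (k.factorial : ℝ) * meanExcess k x
      ≤ excessBound h lam x := by
  have hlam' := hlam.trans hle
  have hs : HasSum (fun k : ℕ => lam' ^ k * Real.exp (-lam') / (k.factorial : ℝ) *
      (2 ^ (n - (separated h x).card) *
        ∑ S ∈ (separated h x).powerset, (1 - S.card * h) ^ k))
      (2 ^ (n - (separated h x).card) *
        ∑ S ∈ (separated h x).powerset, Real.exp (-(lam' * (1 - (1 - S.card * h))))) := by
    have := (hasSum_sum (s := (separated h x).powerset) fun S _ =>
      hasSum_poisson_mul_pow lam' (1 - S.card * h)).mul_left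
        ((2 : ℝ) ^ (n - (separated h x).card))
    convert! this using 2
    rw [← Finset.mul_sum]; ring
  calc _ ≤ _ := (summable_poisson_mul hlam' fun k => abs_meanExcess_le k x).tsum_le_tsum
        (fun k => mul_le_mul_of_nonneg_left (meanExcess_le_sum k x h0) (by positivity)) hs.summable
    _ = _ := hs.tsum_eq
    _ ≤ _ := by
      refine mul_le_mul_of_nonneg_left ?_ (by positivity)
      refine le_trans (Finset.sum_le_sum fun S hS => ?_)
        (sum_powerset_pow_le (separated h x) (Real.exp_pos _).le)
      rw [← Real.exp_nat_mul, Real.exp_le_exp]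
      have : 0 ≤ (S.card : ℝ) * h := by positivity
      nlinarith

lemma Z_le {m n : ℕ} (x : Fin n → I) (y : Fin n → Bool) {h lam : ℝ} (h0 : 0 ≤ h) (hm : lam ≤ m) :
    Z m x y ≤ (1 / 2) ^ n * excessBound h lam x :=
  (Z_le_meanExcess m x y).trans
    (mul_le_mul_of_nonneg_left (meanExcess_le x h0 hm) (by positivity))

/-- The tangent is taken at M = `excessBound`: as the mean is at most M, 2/M - mean/M² ≥ 1/M. -/
lemma le_Z {m n : ℕ} (x : Fin n → I) (y : Fin n → Bool) {h lam : ℝ} (h0 : 0 ≤ h) (hm : lam ≤ m) :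
    (1 / 2) ^ n * (excessBound h lam x)⁻¹ ≤ Z m x y := by
  have hM := excessBound_pos h lam x
  refine le_trans (mul_le_mul_of_nonneg_left ?_ (by positivity)) (tangent_le_Z m x y hM)
  have h1 : meanExcess m x / excessBound h lam x ^ 2 ≤ (excessBound h lam x)⁻¹ := by
    rw [div_le_iff₀ (by positivity), pow_two, inv_mul_cancel_left₀ hM.ne']
    exact meanExcess_le x h0 hm
  rw [div_eq_mul_inv]
  linarith

lemma Zstar_le {n : ℕ} (x : Fin n → I) (y : Fin n → Bool) {h lam lam' : ℝ} (h0 : 0 ≤ h)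
    (hlam : 0 ≤ lam) (hle : lam ≤ lam') :
    Zstar lam' x y ≤ (1 / 2) ^ n * excessBound h lam x := by
  have hlam' := hlam.trans hle
  refine le_trans ?_ (mul_le_mul_of_nonneg_left (tsum_meanExcess_le x h0 hlam hle)
    (by positivity : (0 : ℝ) ≤ (1 / 2) ^ n))
  rw [← tsum_mul_left]
  refine (summable_poisson_mul hlam' fun k => abs_Z_le k x y).tsum_le_tsum (fun k => ?_)
    ((summable_poisson_mul hlam' fun k => abs_meanExcess_le k x).mul_left _)
  rw [mul_left_comm]
  exact mul_le_mul_of_nonneg_left (Z_le_meanExcess k x y) (by positivity)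

lemma le_Zstar {n : ℕ} (x : Fin n → I) (y : Fin n → Bool) {h lam lam' : ℝ} (h0 : 0 ≤ h)
    (hlam : 0 ≤ lam) (hle : lam ≤ lam') :
    (1 / 2) ^ n * (excessBound h lam x)⁻¹ ≤ Zstar lam' x y := by
  have hlam' := hlam.trans hle
  have hM := excessBound_pos h lam x
  set M := excessBound h lam x
  have hs := ((hasSum_poisson lam').mul_right ((1 / 2 : ℝ) ^ n * (2 / M))).sub
    ((summable_poisson_mul hlam' fun k => abs_meanExcess_le k x).hasSum.mul_left
      ((1 / 2 : ℝ) ^ n / M ^ 2))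
  have hle' : (1 / 2 : ℝ) ^ n * M⁻¹ ≤ 1 * ((1 / 2 : ℝ) ^ n * (2 / M)) -
      (1 / 2 : ℝ) ^ n / M ^ 2 *
      ∑' k : ℕ, lam' ^ k * Real.exp (-lam') / (k.factorial : ℝ) * meanExcess k x := by
    have h1 := mul_le_mul_of_nonneg_left (tsum_meanExcess_le x h0 hlam hle)
      (by positivity : 0 ≤ (1 / 2 : ℝ) ^ n / M ^ 2)
    have h2 : (1 / 2 : ℝ) ^ n / M ^ 2 * M = (1 / 2 : ℝ) ^ n * M⁻¹ := by
      field_simp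
    have h3 : 1 * ((1 / 2 : ℝ) ^ n * (2 / M)) = 2 * ((1 / 2 : ℝ) ^ n * M⁻¹) := by
      rw [div_eq_mul_inv]; ring
    rw [h3]
    change _ ≤ (1 / 2 : ℝ) ^ n / M ^ 2 * M at h1
    linarith
  refine hle'.trans ?_
  rw [← hs.tsum_eq]
  refine hs.summable.tsum_le_tsum (fun k => ?_) (summable_poisson_mul hlam' fun k => abs_Z_le k x y)
  have h1 := mul_le_mul_of_nonneg_left (tangent_le_Z k x y hM)
    (by positivity : 0 ≤ lam' ^ k * Real.exp (-lam') / (k.factorial : ℝ))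
  refine le_trans (le_of_eq ?_) h1
  ring

/-! ### Crowded points of a uniform sample. -/

/-- The number of points of `x` which are not `separated`. -/
noncomputable def crowded {n : ℕ} (h : ℝ) (x : Fin n → I) : ℕ := n - (separated h x).card

open Classical in
lemma crowded_eq_sum {n : ℕ} (h : ℝ) (x : Fin n → I) :
    crowded h x = ∑ k : Fin n,
      if (x k : ℝ) + h ≤ 1 ∧ ∀ l < k, h < |(x k : ℝ) - x l| then 0 else 1 := by
  have h1 := Finset.card_filter_add_card_filter_not (s := (Finset.univ : Finset (Fin n)))
    (fun k => (x k : ℝ) + h ≤ 1 ∧ ∀ l < k, h < |(x k : ℝ) - x l|)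
  rw [Finset.card_univ, Fintype.card_fin, Finset.card_filter (fun k => ¬ _)] at h1
  simp only [ite_not] at h1
  rw [crowded, separated]
  omega

/-- The points within distance `h` of `1` or of one of the points of `v`. -/
def crowdedZone {n : ℕ} (h : ℝ) (v : Fin n → I) : Set I :=
  {z | ¬ ((z : ℝ) + h ≤ 1 ∧ ∀ l, h < |(z : ℝ) - v l|)}

-- Whether a point is crowded depends on earlier points only, so appending a point leaves the status
-- of the others unchanged.
open Classical in
lemma crowded_succ {n : ℕ} (h : ℝ) (x : Fin (n + 1) → I) :
    crowded h x = crowded h (fun k => x k.castSucc) +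
      if x (Fin.last n) ∈ crowdedZone h (fun k => x k.castSucc) then 1 else 0 := by
  have aux : ∀ p : Fin (n + 1) → Prop, ∀ k : Fin n,
      (∀ l < k.castSucc, p l) ↔ ∀ l < k, p l.castSucc := by
    intro p k
    refine ⟨fun H l hl => H _ (Fin.castSucc_lt_castSucc_iff.2 hl), fun H l hl => ?_⟩
    have hlast : l ≠ Fin.last n := (hl.trans (Fin.castSucc_lt_last k)).ne
    obtain ⟨l, rfl⟩ := Fin.exists_castSucc_eq.2 hlast
    exact H l (Fin.castSucc_lt_castSucc_iff.1 hl)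
  have aux' : ∀ p : Fin (n + 1) → Prop,
      (∀ l < Fin.last n, p l) ↔ ∀ l : Fin n, p l.castSucc := by
    intro p
    refine ⟨fun H l => H _ (Fin.castSucc_lt_last l), fun H l hl => ?_⟩
    obtain ⟨l, rfl⟩ := Fin.exists_castSucc_eq.2 hl.ne
    exact H l
  rw [crowded_eq_sum, crowded_eq_sum, Fin.sum_univ_castSucc]
  simp only [aux, aux', crowdedZone, Set.mem_ofPred_eq]
  congr 1
  split_ifs <;> simp_all

lemma crowded_mono {N n : ℕ} (hn : n ≤ N) (h : ℝ) (x : ℕ → I) :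
    crowded h (fun k : Fin n => x k) ≤ crowded h (fun k : Fin N => x k) := by
  induction N, hn using Nat.le_induction with
  | base => exact le_rfl
  | succ N _ ih =>
    rw [crowded_succ h (fun k : Fin (N + 1) => x k)]
    exact ih.trans (Nat.le_add_right _ _)

lemma volume_near_le (h : ℝ) (w : I) :
    volume {z : I | |(z : ℝ) - w| ≤ h} ≤ ENNReal.ofReal (2 * h) := by
  rw [unitInterval.volume_apply]
  refine (measure_mono (t := Set.Icc ((w : ℝ) - h) (w + h)) ?_).trans ?_
  · rintro _ ⟨z, hz, rfl⟩
    have := abs_le.1 (show |(z : ℝ) - w| ≤ h from hz)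
    constructor <;> linarith
  · rw [Real.volume_Icc]
    exact ENNReal.ofReal_le_ofReal (by linarith)

lemma volume_crowdedZone_le {n : ℕ} {h : ℝ} (h0 : 0 ≤ h) (v : Fin n → I) :
    volume (crowdedZone h v) ≤ ENNReal.ofReal ((2 * n + 2) * h) := by
  have hsub : crowdedZone h v ⊆ {z : I | |(z : ℝ) - (1 : I)| ≤ h} ∪
      ⋃ l ∈ (Finset.univ : Finset (Fin n)), {z : I | |(z : ℝ) - v l| ≤ h} := by
    intro z hz
    have hz' : ¬ ((z : ℝ) + h ≤ 1 ∧ ∀ l, h < |(z : ℝ) - v l|) := hz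
    by_cases h1 : (z : ℝ) + h ≤ 1
    · right
      simp only [h1, true_and, not_forall, not_lt] at hz'
      obtain ⟨l, hl⟩ := hz'
      exact Set.mem_biUnion (Finset.mem_univ l) hl
    · left
      have h2 := z.2.2
      change |(z : ℝ) - 1| ≤ h
      rw [abs_le]
      constructor <;> linarith
  refine (measure_mono hsub).trans ((measure_union_le _ _).trans ?_)
  refine (add_le_add (volume_near_le h 1) ((measure_biUnion_finset_le _ _).trans
    (Finset.sum_le_sum fun l _ => volume_near_le h (v l)))).trans_eq ?_
  rw [Finset.sum_const, Finset.card_univ, Fintype.card_fin, ← ENNReal.ofReal_nsmul,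
    ← ENNReal.ofReal_add (by positivity) (by positivity)]
  congr 1
  rw [nsmul_eq_mul]; ring

lemma measurableSet_crowdedZone_prod {n : ℕ} (h : ℝ) :
    MeasurableSet {p : I × (Fin n → I) | p.1 ∈ crowdedZone h p.2} := by
  have : {p : I × (Fin n → I) | p.1 ∈ crowdedZone h p.2} =
      ({p : I × (Fin n → I) | (p.1 : ℝ) + h ≤ 1} ∩
        ⋂ l, {p : I × (Fin n → I) | h < |(p.1 : ℝ) - p.2 l|})ᶜ := by
    ext p
    simp [crowdedZone]
  rw [this]
  refine ((measurableSet_le (by fun_prop) (by fun_prop)).inter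
    (MeasurableSet.iInter fun l => measurableSet_lt (by fun_prop) ?_)).compl
  have h1 : Measurable fun p : I × (Fin n → I) => (p.1 : ℝ) - p.2 l := by fun_prop
  exact h1.abs

lemma measurable_crowded {n : ℕ} (h : ℝ) : Measurable fun x : Fin n → I => crowded h x := by
  classical
  simp only [crowded_eq_sum]
  refine Finset.measurable_sum _ fun k _ => Measurable.ite ?_ measurable_const measurable_const
  simp only [Set.ofPred_and, Set.ofPred_forall]
  refine (measurableSet_le (by fun_prop) (by fun_prop)).inter
    (MeasurableSet.iInter fun l => MeasurableSet.iInter fun _ =>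
      measurableSet_lt (by fun_prop) ?_)
  have h1 : Measurable fun x : Fin n → I => (x k : ℝ) - x l := by fun_prop
  exact h1.abs

/-- Integrate out the last point first: for fixed earlier points it is crowded with probability at
most p, which costs a factor of at most 1 + a p. -/
lemma lintegral_pow_crowded_le {n : ℕ} {h p : ℝ} (h0 : 0 ≤ h) (hp : (2 * n + 2) * h ≤ p)
    (a : ℝ≥0∞) :
    ∫⁻ x : Fin n → I, a ^ crowded h x ≤ (1 + a * ENNReal.ofReal p) ^ n := by
  classical
  induction n with
  | zero => simp [crowded]
  | succ n ih =>
    have hmeas : Measurable fun v : Fin n → I => a ^ crowded h v :=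
      (Measurable.of_discrete (f := fun k : ℕ => a ^ k)).comp (measurable_crowded h)
    have hmeas' : Measurable fun q : I × (Fin n → I) =>
        a ^ crowded h q.2 * (1 + {q : I × (Fin n → I) | q.1 ∈ crowdedZone h q.2}.indicator
          (fun _ => a) q) :=
      (hmeas.comp measurable_snd).mul
        (Measurable.const_add (measurable_const.indicator (measurableSet_crowdedZone_prod h)) 1)
    have hvol : ∀ v : Fin n → I, volume (crowdedZone h v) ≤ ENNReal.ofReal p := fun v =>
      (volume_crowdedZone_le h0 v).trans (ENNReal.ofReal_le_ofReal (by push_cast at hp; nlinarith))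
    have hle : ∀ x : Fin (n + 1) → I, a ^ crowded h x ≤
        (fun q : I × (Fin n → I) =>
          a ^ crowded h q.2 * (1 + {q : I × (Fin n → I) | q.1 ∈ crowdedZone h q.2}.indicator
            (fun _ => a) q)) (MeasurableEquiv.piFinSuccAbove (fun _ => I) (Fin.last n) x) := by
      intro x
      have hx : MeasurableEquiv.piFinSuccAbove (fun _ => I) (Fin.last n) x =
          (x (Fin.last n), fun k => x k.castSucc) := by
        ext k <;> simp [MeasurableEquiv.piFinSuccAbove, Fin.insertNthEquiv, Fin.init]
      rw [hx, crowded_succ, pow_add]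
      refine mul_le_mul_right ?_ _
      simp only [Set.indicator_apply, Set.mem_ofPred_eq]
      split_ifs <;> simp
    calc ∫⁻ x : Fin (n + 1) → I, a ^ crowded h x
        ≤ _ := lintegral_mono hle
      _ = ∫⁻ q : I × (Fin n → I), a ^ crowded h q.2 *
            (1 + {q : I × (Fin n → I) | q.1 ∈ crowdedZone h q.2}.indicator (fun _ => a) q)
            ∂(volume.prod volume) :=
          (volume_preserving_piFinSuccAbove (fun _ => I) (Fin.last n)).lintegral_comp hmeas'
      _ = ∫⁻ v : Fin n → I, ∫⁻ z : I, a ^ crowded h v *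
            (1 + {q : I × (Fin n → I) | q.1 ∈ crowdedZone h q.2}.indicator (fun _ => a) (z, v)) :=
          lintegral_prod_symm' _ hmeas'
      _ ≤ ∫⁻ v : Fin n → I, a ^ crowded h v * (1 + a * ENNReal.ofReal p) := by
          refine lintegral_mono fun v => ?_
          have hv : MeasurableSet (crowdedZone h v) :=
            (measurableSet_crowdedZone_prod h).preimage measurable_prodMk_right
          have hind : ∀ z : I, {q : I × (Fin n → I) | q.1 ∈ crowdedZone h q.2}.indicator
              (fun _ => a) (z, v) = (crowdedZone h v).indicator (fun _ => a) z := fun z => rfl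
          simp only [hind]
          rw [lintegral_const_mul _ (Measurable.const_add (measurable_const.indicator hv) 1),
            lintegral_add_left measurable_const, lintegral_indicator_const hv]
          simp only [lintegral_const, measure_univ, mul_one]
          gcongr
          exact hvol v
      _ = (∫⁻ v : Fin n → I, a ^ crowded h v) * (1 + a * ENNReal.ofReal p) :=
          lintegral_mul_const _ hmeas
      _ ≤ (1 + a * ENNReal.ofReal p) ^ (n + 1) := by
          rw [pow_succ]
          gcongr
          exact ih (by push_cast at hp; nlinarith)

variable {Ω : Type*} [MeasurableSpace Ω] {P : Measure Ω}

lemma IsUniformSample.hasLaw_sample [IsProbabilityMeasure P] {X : ℕ → Ω → I}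
    (hX : IsUniformSample P X) (n : ℕ) : HasLaw (sample X n) volume P :=
  iIndepFun.hasLaw_pi (fun k : Fin n => hX.law k) (hX.indep.precomp Fin.val_injective)

/-- Few of the first `2 n` points of a uniform sample are within distance `c / n` of an earlier
one, if `c` is small. -/
lemma exists_tendsto_crowded {ε : ℝ} (hε : 0 < ε) : ∃ c : ℝ, 0 < c ∧
    ∀ (Ω : Type v) [MeasurableSpace Ω] (P : Measure Ω) [IsProbabilityMeasure P]
      (X : ℕ → Ω → I), IsUniformSample P X →
      Tendsto (fun n : ℕ => P {ω | ε * n < crowded (c / n) (sample X (2 * n) ω)})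
        atTop (𝓝 0) := by
  -- With this b, more than εn crowded points force b^crowded ≥ 8^n. With c = 1/(6b) the crowding
  -- probability is at most (4n + 2)c/n ≤ 1/b, so the moment is at most (1 + 1)^(2n) = 4^n, and
  -- Markov's inequality leaves 2^(-n).
  set b : ℝ := (8 : ℝ) ^ (1 / ε) with hb
  have hb0 : 0 < b := by positivity
  have hb1 : 1 ≤ b := Real.one_le_rpow (by norm_num) (by positivity)
  refine ⟨1 / (6 * b), by positivity, fun Ω _ P _ X hX => ?_⟩
  set c : ℝ := 1 / (6 * b) with hc
  have hbound : ∀ n : ℕ, 1 ≤ n →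
      P {ω | ε * n < crowded (c / n) (sample X (2 * n) ω)} ≤ (2⁻¹ : ℝ≥0∞) ^ n := by
    intro n hn
    have hn0 : (1 : ℝ) ≤ n := by exact_mod_cast hn
    have hmeas : MeasurableSet {x : Fin (2 * n) → I | ε * n < crowded (c / n) x} :=
      measurableSet_lt measurable_const
        ((Measurable.of_discrete (f := fun k : ℕ => (k : ℝ))).comp (measurable_crowded _))
    have h1 : P {ω | ε * n < crowded (c / n) (sample X (2 * n) ω)} =
        volume {x : Fin (2 * n) → I | ε * n < crowded (c / n) x} :=
      (hX.hasLaw_sample (2 * n)).measure_eq hmeas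
    have h2 := lintegral_pow_crowded_le (n := 2 * n) (h := c / n) (p := 1 / b) (by positivity)
      (by
        rw [hc]
        push_cast
        rw [div_div, mul_one_div, div_le_div_iff₀ (by positivity) hb0]
        nlinarith) (ENNReal.ofReal b)
    rw [← ENNReal.ofReal_mul hb0.le, mul_one_div_cancel hb0.ne', ENNReal.ofReal_one,
      one_add_one_eq_two, pow_mul] at h2
    have h3 := mul_meas_ge_le_lintegral (μ := (volume : Measure (Fin (2 * n) → I)))
      (f := fun x => ENNReal.ofReal b ^ crowded (c / n) x)
      ((Measurable.of_discrete (f := fun k : ℕ => ENNReal.ofReal b ^ k)).comp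
        (measurable_crowded _)) (8 ^ n)
    have hsub : {x : Fin (2 * n) → I | ε * n < crowded (c / n) x} ⊆
        {x | (8 : ℝ≥0∞) ^ n ≤ ENNReal.ofReal b ^ crowded (c / n) x} := by
      intro x hx
      have hx' : ε * n < crowded (c / n) x := hx
      have h4 : (8 : ℝ) ^ n ≤ b ^ crowded (c / n) x := by
        rw [hb, ← Real.rpow_natCast, ← Real.rpow_natCast, ← Real.rpow_mul (by norm_num)]
        refine Real.rpow_le_rpow_of_exponent_le (by norm_num) ?_
        rw [one_div, inv_mul_eq_div, le_div_iff₀ hε]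
        linarith
      have h5 := ENNReal.ofReal_le_ofReal h4
      rw [ENNReal.ofReal_pow (by norm_num), ENNReal.ofReal_pow hb0.le] at h5
      simpa using h5
    rw [h1]
    have h6 : (8 : ℝ≥0∞) ^ n * volume {x : Fin (2 * n) → I | ε * n < crowded (c / n) x} ≤
        (2 ^ 2) ^ n := (mul_le_mul_right (measure_mono hsub) _).trans (h3.trans h2)
    rw [mul_comm, ← ENNReal.le_div_iff_mul_le (.inl (by simp)) (.inl (by simp))] at h6
    refine h6.trans_eq ?_
    have h8 : (8 : ℝ≥0∞) = 2 ^ 2 * 2 := by norm_num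
    rw [h8, mul_pow, div_eq_mul_inv, ENNReal.mul_inv (.inr (by simp)) (.inl (by simp)),
      ← mul_assoc, ENNReal.mul_inv_cancel (by simp) (by simp), one_mul, ENNReal.inv_pow]
  refine tendsto_of_tendsto_of_tendsto_of_le_of_le' tendsto_const_nhds
    (ENNReal.tendsto_pow_atTop_nhds_zero_of_lt_one (by simp)) (.of_forall fun n => zero_le)
    (eventually_atTop.2 ⟨1, hbound⟩)

/-! ### Deviations of the Poisson sample size. -/

/-- Shifting the index absorbs one factor k into the factorial; doing so twice gives the first two
moments. -/
lemma hasSum_poisson_variance (r : ℝ≥0) :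
    HasSum (fun k : ℕ => (Real.exp (-r) * r ^ k / (k.factorial : ℝ)) * ((k : ℝ) - r) ^ 2) r := by
  have hstep : ∀ k : ℕ, Real.exp (-r) * r ^ (k + 1) / ((k + 1).factorial : ℝ) * ((k + 1 : ℕ) : ℝ)
      = r * (Real.exp (-r) * r ^ k / (k.factorial : ℝ)) := by
    intro k
    rw [Nat.factorial_succ]
    push_cast
    field_simp
    ring
  have h0 := hasSum_one_poissonMeasure r
  have h1 : HasSum (fun k : ℕ => (Real.exp (-r) * r ^ k / (k.factorial : ℝ)) * (k : ℝ)) r := by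
    rw [← hasSum_nat_add_iff' 1]
    simp only [hstep]
    simpa using h0.mul_left (r : ℝ)
  have h2 : HasSum (fun k : ℕ => (Real.exp (-r) * r ^ k / (k.factorial : ℝ)) * (k : ℝ) * k)
      (r * r + r) := by
    rw [← hasSum_nat_add_iff' 1]
    simp only [hstep]
    have := (h1.mul_left (r : ℝ)).add (h0.mul_left (r : ℝ))
    convert! this using 1
    · ext k; push_cast; ring
    · simp
  have := (h2.sub (h1.mul_left (2 * r : ℝ))).add (h0.mul_left ((r : ℝ) ^ 2))
  convert! this using 1
  · ext k; ring
  · ring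

lemma poissonMeasure_deviation_le {r : ℝ≥0} {t : ℝ} (ht : 0 < t) :
    (poissonMeasure r).real {k : ℕ | t ≤ |(k : ℝ) - r|} ≤ r / t ^ 2 := by
  have hint : Integrable (fun k : ℕ => ((k : ℝ) - r) ^ 2) (poissonMeasure r) := by
    rw [integrable_poissonMeasure_iff]
    simpa using (hasSum_poisson_variance r).summable
  have h1 := mul_meas_ge_le_integral_of_nonneg (ae_of_all _ fun k : ℕ => sq_nonneg ((k : ℝ) - r))
    hint (t ^ 2)
  rw [integral_poissonMeasure] at h1
  simp only [smul_eq_mul, (hasSum_poisson_variance r).tsum_eq] at h1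
  rw [le_div_iff₀ (by positivity), mul_comm]
  convert! h1 using 4
  ext k
  rw [← sq_abs ((k : ℝ) - r), pow_le_pow_iff_left₀ ht.le (abs_nonneg _) (by norm_num)]

lemma IsPoissonProcess.tendsto_deviation [IsProbabilityMeasure P] {L : ℝ≥0 → Ω → ℕ}
    (hL : IsPoissonProcess P L) {ε : ℝ} (hε : 0 < ε) :
    Tendsto (fun n : ℕ => P {ω | ε * n ≤ |(L n ω : ℝ) - n|}) atTop (𝓝 0) := by
  -- Since L 0 = 0 almost surely, L n is the increment over [0, n].
  have hlaw : ∀ n : ℕ, HasLaw (L n) (poissonMeasure n) P := by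
    intro n
    have h := hL.law 0 n zero_le
    rw [tsub_zero] at h
    refine h.congr ?_
    filter_upwards [hL.paths] with ω hω
    simp [hω.1]
  have hlim : Tendsto (fun n : ℕ => ENNReal.ofReal ((ε ^ 2)⁻¹ * (n : ℝ)⁻¹)) atTop (𝓝 0) := by
    have := ENNReal.tendsto_ofReal ((tendsto_inv_atTop_nhds_zero_nat (𝕜 := ℝ)).const_mul (ε ^ 2)⁻¹)
    simpa using this
  refine tendsto_of_tendsto_of_tendsto_of_le_of_le' tendsto_const_nhds hlim
    (.of_forall fun n => zero_le) (eventually_atTop.2 ⟨1, fun n hn => ?_⟩)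
  have hn0 : (0 : ℝ) < n := by exact_mod_cast hn
  have h1 := poissonMeasure_deviation_le (r := n) (t := ε * n) (by positivity)
  have h2 : P {ω | ε * n ≤ |(L n ω : ℝ) - n|} =
      poissonMeasure n {k : ℕ | ε * n ≤ |(k : ℝ) - n|} :=
    (hlaw n).measure_eq (p := fun k : ℕ => ε * n ≤ |(k : ℝ) - n|) (MeasurableSet.of_discrete)
  rw [h2, ← ofReal_measureReal]
  refine ENNReal.ofReal_le_ofReal (h1.trans_eq ?_)
  simp only [NNReal.coe_natCast]
  field_simp

/-! ### Choice of constants and uniform bounds. -/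

lemma exists_exp_neg_mul_lt {c η : ℝ} (hc : 0 < c) (hη : 0 < η) :
    ∃ a : ℝ, 0 < a ∧ Real.exp (-(a * c)) < η := by
  have h : Tendsto (fun a : ℝ => Real.exp (-(a * c))) atTop (𝓝 0) :=
    Real.tendsto_exp_neg_atTop_nhds_zero.comp (tendsto_id.atTop_mul_const hc)
  obtain ⟨a, h1, h2⟩ := ((h.eventually_lt_const hη).and (eventually_gt_atTop 0)).exists
  exact ⟨a, h2, h1⟩

lemma excessBound_le {n N : ℕ} (hn : 1 ≤ n) (hN : N ≤ 2 * n) {a c ε : ℝ}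
    (ha : Real.exp (-(a * c)) ≤ ε * Real.log 2 / 2) (x : Fin N → I)
    (hx : crowded (c / n) x ≤ ε * n) :
    excessBound (c / n) (a * n) x ≤ (2 : ℝ) ^ (2 * ε * n) := by
  have hn0 : (n : ℝ) ≠ 0 := by positivity
  have hexp : -(a * n * (c / n)) = -(a * c) := by field_simp
  have h1 : ((2 : ℝ) ^ (N - (separated (c / n) x).card)) ≤ (2 : ℝ) ^ (ε * n) := by
    rw [← Real.rpow_natCast]
    exact Real.rpow_le_rpow_of_exponent_le (by norm_num) hx
  have h2 : (1 + Real.exp (-(a * n * (c / n)))) ^ N ≤ (2 : ℝ) ^ (ε * n) := by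
    rw [hexp]
    calc (1 + Real.exp (-(a * c))) ^ N
        ≤ (1 + Real.exp (-(a * c))) ^ (2 * n) :=
          pow_le_pow_right₀ (by linarith [Real.exp_pos (-(a * c))]) hN
      _ ≤ (Real.exp (ε * Real.log 2 / 2)) ^ (2 * n) := by
          -- 1 + t ≤ exp t at t = ε log 2 / 2; the power 2n then gives exactly 2^(εn).
          refine pow_le_pow_left₀ (by positivity) ?_ _
          linarith [Real.add_one_le_exp (ε * Real.log 2 / 2)]
      _ = (2 : ℝ) ^ (ε * n) := by
          rw [← Real.exp_nat_mul, Real.rpow_def_of_pos (by norm_num)]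
          congr 1
          push_cast
          ring
  calc excessBound (c / n) (a * n) x ≤ (2 : ℝ) ^ (ε * n) * (2 : ℝ) ^ (ε * n) :=
        mul_le_mul h1 h2 (by positivity) (by positivity)
    _ = (2 : ℝ) ^ (2 * ε * n) := by
        rw [← Real.rpow_add (by norm_num)]; congr 1; ring

/-- If the sample size `N` is close to `n` and few points are crowded, then `Z` and `Zstar` are
close to `2 ^ (-n)` on an exponential scale, uniformly in the responses and in the rate. -/
lemma bounds_of_crowded_le {n N : ℕ} (hn : 1 ≤ n) {a c ε δ : ℝ} (ha0 : 0 < a) (hc : 0 < c)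
    (hε1 : ε ≤ 1) (hεδ : 3 * ε ≤ δ) (ha : Real.exp (-(a * c)) ≤ ε * Real.log 2 / 2)
    (hN : |(N : ℝ) - n| ≤ ε * n) (x : ℕ → I)
    (hx : crowded (c / n) (fun k : Fin (2 * n) => x k) ≤ ε * n) (y : Fin N → Bool) :
    (∀ α, a ≤ α →
      (2 : ℝ) ^ (-(n : ℝ) - n * δ) ≤ Zstar (α * n) (fun k : Fin N => x k) y ∧
      Zstar (α * n) (fun k : Fin N => x k) y ≤ (2 : ℝ) ^ (-(n : ℝ) + n * δ)) ∧
    (∀ m : ℕ, a * n ≤ m →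
      (2 : ℝ) ^ (-(n : ℝ) - n * δ) ≤ Z m (fun k : Fin N => x k) y ∧
      Z m (fun k : Fin N => x k) y ≤ (2 : ℝ) ^ (-(n : ℝ) + n * δ)) := by
  have hn0 : (0 : ℝ) < n := by exact_mod_cast hn
  obtain ⟨hN1, hN2⟩ := abs_le.1 hN
  have hNn : N ≤ 2 * n := by
    have : (N : ℝ) ≤ 2 * n := by nlinarith
    exact_mod_cast this
  have hx' : (crowded (c / n) (fun k : Fin N => x k) : ℝ) ≤ ε * n :=
    le_trans (by exact_mod_cast crowded_mono hNn _ x) hx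
  have hM := excessBound_le hn hNn ha _ hx'
  have hM0 := excessBound_pos (c / n) (a * n) (fun k : Fin N => x k)
  have hpow : ((1 / 2 : ℝ)) ^ N = (2 : ℝ) ^ (-(N : ℝ)) := by
    rw [Real.rpow_neg (by norm_num), Real.rpow_natCast, one_div, inv_pow]
  -- Replacing N by n costs εn in the exponent and the excess costs 2εn, whence 3ε ≤ δ.
  have hup : (1 / 2 : ℝ) ^ N * excessBound (c / n) (a * n) (fun k : Fin N => x k) ≤
      (2 : ℝ) ^ (-(n : ℝ) + n * δ) := by
    refine (mul_le_mul_of_nonneg_left hM (by positivity)).trans ?_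
    rw [hpow, ← Real.rpow_add (by norm_num)]
    exact Real.rpow_le_rpow_of_exponent_le (by norm_num) (by nlinarith)
  have hlow : (2 : ℝ) ^ (-(n : ℝ) - n * δ) ≤
      (1 / 2 : ℝ) ^ N * (excessBound (c / n) (a * n) (fun k : Fin N => x k))⁻¹ := by
    refine le_trans ?_ (mul_le_mul_of_nonneg_left (inv_anti₀ hM0 hM) (by positivity))
    rw [hpow, ← Real.rpow_neg (by norm_num), ← Real.rpow_add (by norm_num)]
    exact Real.rpow_le_rpow_of_exponent_le (by norm_num) (by nlinarith)
  have h0 : 0 ≤ c / n := by positivity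
  have hl : 0 ≤ a * n := by positivity
  refine ⟨fun α hα => ?_, fun m hm => ?_⟩
  · have hα' : a * n ≤ α * n := mul_le_mul_of_nonneg_right hα hn0.le
    exact ⟨hlow.trans (le_Zstar _ y h0 hl hα'), (Zstar_le _ y h0 hl hα').trans hup⟩
  · exact ⟨hlow.trans (le_Z _ y h0 hm), (Z_le _ y h0 hm).trans hup⟩

lemma tendsto_measure_zero_of_subset {Ω : Type*} [MeasurableSpace Ω] {P : Measure Ω}
    {A B : ℕ → Set Ω} (hB : Tendsto (fun n => P (B n)) atTop (𝓝 0))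
    (h : ∀ n, 1 ≤ n → A n ⊆ B n) : Tendsto (fun n => P (A n)) atTop (𝓝 0) :=
  tendsto_of_tendsto_of_tendsto_of_le_of_le' tendsto_const_nhds hB
    (.of_forall fun _ => zero_le) (eventually_atTop.2 ⟨1, fun n hn => measure_mono (h n hn)⟩)

lemma tendsto_measure_union_zero {Ω : Type*} [MeasurableSpace Ω] {P : Measure Ω}
    {A B : ℕ → Set Ω} (hA : Tendsto (fun n => P (A n)) atTop (𝓝 0))
    (hB : Tendsto (fun n => P (B n)) atTop (𝓝 0)) :
    Tendsto (fun n => P (A n ∪ B n)) atTop (𝓝 0) := by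
  have h := hA.add hB
  rw [add_zero] at h
  exact tendsto_of_tendsto_of_tendsto_of_le_of_le tendsto_const_nhds h
    (fun _ => zero_le) fun n => measure_union_le _ _

lemma two_rpow_lt {n : ℕ} (hn : 1 ≤ n) {s t : ℝ} (h : s < t) :
    (2 : ℝ) ^ (-(n : ℝ) + n * s) < (2 : ℝ) ^ (-(n : ℝ) + n * t) := by
  have hn0 : (0 : ℝ) < n := by exact_mod_cast hn
  exact Real.rpow_lt_rpow_of_exponent_lt (by norm_num)
    (by linarith [mul_lt_mul_of_pos_left h hn0])

/-- `Z` and `Zstar` are uniformly close to `2 ^ (-n)` on an exponential scale, with probability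
tending to `1`. -/
theorem exists_uniform_bounds {δ : ℝ} (hδ : 0 < δ) : ∃ a : ℝ, 0 < a ∧
    ∀ (Ω : Type v) [MeasurableSpace Ω] (P : Measure Ω) [IsProbabilityMeasure P]
      (X : ℕ → Ω → I), IsUniformSample P X →
      (∀ L : ℝ≥0 → Ω → ℕ, IsPoissonProcess P L →
        Tendsto (fun n : ℕ => P {ω | (2 : ℝ) ^ (-(n : ℝ) + n * δ) ≤
          (⨆ α : Set.Ici a, ⨆ y : Fin (L n ω) → Bool,
            Zstar ((α : ℝ) * n) (sample X (L n ω) ω) y)}) atTop (𝓝 0) ∧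
        Tendsto (fun n : ℕ => P {ω |
          (⨅ α : Set.Ici a, ⨅ y : Fin (L n ω) → Bool,
            Zstar ((α : ℝ) * n) (sample X (L n ω) ω) y)
              ≤ (2 : ℝ) ^ (-(n : ℝ) - n * δ)}) atTop (𝓝 0) ∧
        ∀ α, a ≤ α → ∀ Y : ℕ → Ω → Bool, Tendsto (fun n : ℕ => P {ω |
          ¬ ((2 : ℝ) ^ (-(n : ℝ) - n * δ) ≤
              Zstar (α * n) (sample X (L n ω) ω) (sample Y (L n ω) ω) ∧
            Zstar (α * n) (sample X (L n ω) ω) (sample Y (L n ω) ω) ≤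
              (2 : ℝ) ^ (-(n : ℝ) + n * δ))}) atTop (𝓝 0)) ∧
      Tendsto (fun n : ℕ => P {ω | (2 : ℝ) ^ (-(n : ℝ) + n * δ) ≤
        (⨆ m : {m : ℕ // a * n ≤ m}, ⨆ y : Fin n → Bool, Z m (sample X n ω) y)})
          atTop (𝓝 0) ∧
      Tendsto (fun n : ℕ => P {ω |
        (⨅ m : {m : ℕ // a * n ≤ m}, ⨅ y : Fin n → Bool, Z m (sample X n ω) y)
          ≤ (2 : ℝ) ^ (-(n : ℝ) - n * δ)}) atTop (𝓝 0) := by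
  -- The bounds are proved with δ/2 in place of δ: the exceptional events are closed inequalities,
  -- so a strict gap is needed after taking suprema and infima.
  set ε : ℝ := min 1 (δ / 6) with hε
  have hε0 : 0 < ε := lt_min one_pos (by positivity)
  have hε1 : ε ≤ 1 := min_le_left _ _
  have hεδ : 3 * ε ≤ δ / 2 := by linarith [min_le_right 1 (δ / 6)]
  obtain ⟨c, hc, hcrowd⟩ := exists_tendsto_crowded.{v} hε0
  obtain ⟨a, ha0, ha⟩ := exists_exp_neg_mul_lt (η := ε * Real.log 2 / 2) hc (by positivity)
  refine ⟨a, ha0, fun Ω _ P _ X hX => ?_⟩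
  have hbad := hcrowd Ω P X hX
  have hlt : ∀ n : ℕ, 1 ≤ n →
      (2 : ℝ) ^ (-(n : ℝ) + n * (δ / 2)) < (2 : ℝ) ^ (-(n : ℝ) + n * δ) ∧
      (2 : ℝ) ^ (-(n : ℝ) - n * δ) < (2 : ℝ) ^ (-(n : ℝ) - n * (δ / 2)) := by
    intro n hn
    refine ⟨two_rpow_lt hn (by linarith), ?_⟩
    have := two_rpow_lt hn (show -δ < -(δ / 2) by linarith)
    simpa only [mul_neg, ← sub_eq_add_neg] using this
  refine ⟨fun L hL => ?_, ?_, ?_⟩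
  · have hev := tendsto_measure_union_zero hbad (hL.tendsto_deviation hε0)
    have hgood : ∀ n : ℕ, 1 ≤ n → ∀ ω, ω ∉ {ω | ε * n < crowded (c / n) (sample X (2 * n) ω)} ∪
        {ω | ε * n ≤ |(L n ω : ℝ) - n|} → ∀ y : Fin (L n ω) → Bool, ∀ α, a ≤ α →
        (2 : ℝ) ^ (-(n : ℝ) - n * (δ / 2)) ≤ Zstar (α * n) (sample X (L n ω) ω) y ∧
        Zstar (α * n) (sample X (L n ω) ω) y ≤ (2 : ℝ) ^ (-(n : ℝ) + n * (δ / 2)) := by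
      intro n hn ω hω y
      simp only [Set.mem_union, Set.mem_ofPred_eq, not_or, not_lt, not_le] at hω
      exact (bounds_of_crowded_le hn ha0 hc hε1 hεδ ha.le hω.2.le (fun k => X k ω) hω.1 y).1
    refine ⟨tendsto_measure_zero_of_subset hev fun n hn ω hω => ?_,
      tendsto_measure_zero_of_subset hev fun n hn ω hω => ?_,
      fun α hα Y => tendsto_measure_zero_of_subset hev fun n hn ω hω => ?_⟩
    · by_contra hω'
      refine absurd (show _ ≤ _ from hω) (not_le.2 (lt_of_le_of_lt ?_ (hlt n hn).1))
      exact ciSup_le fun α => ciSup_le fun y => (hgood n hn ω hω' y α α.2).2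
    · by_contra hω'
      refine absurd (show _ ≤ _ from hω) (not_le.2 (lt_of_lt_of_le (hlt n hn).2 ?_))
      exact le_ciInf fun α => le_ciInf fun y => (hgood n hn ω hω' y α α.2).1
    · by_contra hω'
      have := hgood n hn ω hω' (sample Y (L n ω) ω) α hα
      exact hω ⟨(hlt n hn).2.le.trans this.1, this.2.trans (hlt n hn).1.le⟩
  all_goals
    have hgood : ∀ n : ℕ, 1 ≤ n → ∀ ω, ω ∉ {ω | ε * n < crowded (c / n) (sample X (2 * n) ω)} →
        ∀ y : Fin n → Bool, ∀ m : ℕ, a * n ≤ m →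
        (2 : ℝ) ^ (-(n : ℝ) - n * (δ / 2)) ≤ Z m (sample X n ω) y ∧
        Z m (sample X n ω) y ≤ (2 : ℝ) ^ (-(n : ℝ) + n * (δ / 2)) := by
      intro n hn ω hω y
      simp only [Set.mem_ofPred_eq, not_lt] at hω
      exact (bounds_of_crowded_le hn ha0 hc hε1 hεδ ha.le
        (by simpa using mul_nonneg hε0.le (Nat.cast_nonneg n)) (fun k => X k ω) hω y).2
    -- Over an empty index set a real infimum would be 0 and the lower bound would fail.
    have hne : ∀ n : ℕ, Nonempty {m : ℕ // a * n ≤ m} := fun n => ⟨⟨_, Nat.le_ceil _⟩⟩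
    refine tendsto_measure_zero_of_subset hbad fun n hn ω hω => ?_
    by_contra hω'
  · refine absurd (show _ ≤ _ from hω) (not_le.2 (lt_of_le_of_lt ?_ (hlt n hn).1))
    exact ciSup_le fun m => ciSup_le fun y => (hgood n hn ω hω' y m m.2).2
  · refine absurd (show _ ≤ _ from hω) (not_le.2 (lt_of_lt_of_le (hlt n hn).2 ?_))
    exact le_ciInf fun m => le_ciInf fun y => (hgood n hn ω hω' y m m.2).1

/-! ### The exponential rate for large α. -/

lemma IsDataStream.isUniformSample {Ω : Type*} [MeasurableSpace Ω] {P : Measure Ω} {f : I → I}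
    {X : ℕ → Ω → I} {Y : ℕ → Ω → Bool} (h : IsDataStream f P X Y) : IsUniformSample P X where
  indep := h.indep.comp (fun _ => Prod.fst) fun _ => measurable_fst
  law := h.law

lemma not_tendsto_zero_both {Ω : Type*} [MeasurableSpace Ω] {P : Measure Ω}
    [IsProbabilityMeasure P] {A B : ℕ → Set Ω} (hA : Tendsto (fun n => P (A n)) atTop (𝓝 0))
    (hB : Tendsto (fun n => P (B n)) atTop (𝓝 0)) (h : ∀ n, A n ∪ B n = Set.univ) : False := by
  have := tendsto_measure_union_zero hA hB
  simp only [h, measure_univ] at this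
  exact one_ne_zero (tendsto_nhds_unique tendsto_const_nhds this)

/-- For large `α`, the exponential rate of `Zstar` is close to `-log 2` with probability tending
to `1`. -/
theorem exists_logPredictive_bounds {η : ℝ} (hη : 0 < η) : ∃ a : ℝ, 0 < a ∧
    ∀ (Ω : Type v) [MeasurableSpace Ω] (P : Measure Ω) [IsProbabilityMeasure P]
      (X : ℕ → Ω → I) (Y : ℕ → Ω → Bool) (L : ℝ≥0 → Ω → ℕ), IsUniformSample P X →
      IsPoissonProcess P L → ∀ α, a ≤ α →
      Tendsto (fun n : ℕ => P {ω | -Real.log 2 + η < logPredictive X Y L α n ω}) atTop (𝓝 0) ∧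
      Tendsto (fun n : ℕ => P {ω | logPredictive X Y L α n ω < -Real.log 2 - η}) atTop (𝓝 0) := by
  have hlog : 0 < Real.log 2 := Real.log_pos (by norm_num)
  -- With this δ, 2^(nδ) = exp(nη).
  obtain ⟨a, ha0, ha⟩ := exists_uniform_bounds.{v} (δ := η / Real.log 2) (by positivity)
  refine ⟨a, ha0, fun Ω _ P _ X Y L hX hL α hα => ?_⟩
  have h := ((ha Ω P X hX).1 L hL).2.2 α hα Y
  have hkey : ∀ n : ℕ, 1 ≤ n → ∀ z : ℝ, (2 : ℝ) ^ (-(n : ℝ) - n * (η / Real.log 2)) ≤ z →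
      z ≤ (2 : ℝ) ^ (-(n : ℝ) + n * (η / Real.log 2)) →
      -Real.log 2 - η ≤ (n : ℝ)⁻¹ * Real.log z ∧ (n : ℝ)⁻¹ * Real.log z ≤ -Real.log 2 + η := by
    intro n hn z h1 h2
    have hn0 : (0 : ℝ) < n := by exact_mod_cast hn
    have hz : 0 < z := lt_of_lt_of_le (by positivity) h1
    have h1' := Real.log_le_log (by positivity) h1
    have h2' := Real.log_le_log hz h2
    rw [Real.log_rpow (by norm_num)] at h1' h2'
    have e1 : (-(n : ℝ) - n * (η / Real.log 2)) * Real.log 2 = n * (-Real.log 2 - η) := by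
      field_simp
    have e2 : (-(n : ℝ) + n * (η / Real.log 2)) * Real.log 2 = n * (-Real.log 2 + η) := by
      field_simp
    rw [e1] at h1'
    rw [e2] at h2'
    rw [inv_mul_eq_div, le_div_iff₀' hn0, div_le_iff₀' hn0]
    exact ⟨h1', h2'⟩
  refine ⟨tendsto_measure_zero_of_subset h fun n hn ω hω hb => ?_,
    tendsto_measure_zero_of_subset h fun n hn ω hω hb => ?_⟩
  · exact absurd (show _ < _ from hω) (not_lt.2 (hkey n hn _ hb.1 hb.2).2)
  · exact absurd (show _ < _ from hω) (not_lt.2 (hkey n hn _ hb.1 hb.2).1)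

section Rate

variable {Ω : Type*} [MeasurableSpace Ω] {P : Measure Ω}
  {X : ℕ → Ω → I} {Y : ℕ → Ω → Bool} {L : ℝ≥0 → Ω → ℕ} {α b₁ b₂ : ℝ}

/-- If c < d the two events cover the whole space, so their probabilities cannot both vanish in the
limit. -/
lemma le_of_tendsto_upper_lower [IsProbabilityMeasure P] {c d : ℝ}
    (hc : Tendsto (fun n : ℕ => P {ω | c < logPredictive X Y L α n ω}) atTop (𝓝 0))
    (hd : Tendsto (fun n : ℕ => P {ω | logPredictive X Y L α n ω < d}) atTop (𝓝 0)) : d ≤ c := by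
  by_contra! hcd
  refine not_tendsto_zero_both hc hd fun n => Set.eq_univ_of_forall fun ω => ?_
  rcases lt_or_ge c (logPredictive X Y L α n ω) with h | h
  · exact .inl h
  · exact .inr (lt_of_le_of_lt h hcd)

/-- The two hypotheses also show that the defining set is nonempty and bounded below, so that `sInf`
is a genuine infimum. -/
lemma upperRate_mem_Icc [IsProbabilityMeasure P]
    (h₂ : Tendsto (fun n : ℕ => P {ω | b₂ < logPredictive X Y L α n ω}) atTop (𝓝 0))
    (h₁ : Tendsto (fun n : ℕ => P {ω | logPredictive X Y L α n ω < b₁}) atTop (𝓝 0)) :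
    upperRate P X Y L α ∈ Set.Icc b₁ b₂ :=
  ⟨le_csInf ⟨b₂, h₂⟩ fun _ hc => le_of_tendsto_upper_lower hc h₁,
    csInf_le ⟨b₁, fun _ hc => le_of_tendsto_upper_lower hc h₁⟩ h₂⟩

lemma lowerRate_mem_Icc [IsProbabilityMeasure P]
    (h₂ : Tendsto (fun n : ℕ => P {ω | b₂ < logPredictive X Y L α n ω}) atTop (𝓝 0))
    (h₁ : Tendsto (fun n : ℕ => P {ω | logPredictive X Y L α n ω < b₁}) atTop (𝓝 0)) :
    lowerRate P X Y L α ∈ Set.Icc b₁ b₂ :=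
  ⟨le_csSup ⟨b₂, fun _ hc => le_of_tendsto_upper_lower h₂ hc⟩ h₁,
    csSup_le ⟨b₁, h₁⟩ fun _ hc => le_of_tendsto_upper_lower h₂ hc⟩

lemma IsRate.tendsto_upper {c d : ℝ} (hc : IsRate P X Y L α c) (hd : c < d) :
    Tendsto (fun n : ℕ => P {ω | d < logPredictive X Y L α n ω}) atTop (𝓝 0) := by
  refine tendsto_measure_zero_of_subset
    (tendstoInMeasure_iff_dist.1 hc (d - c) (by linarith)) fun n _ ω hω => ?_
  have h : d < logPredictive X Y L α n ω := hω
  change d - c ≤ |logPredictive X Y L α n ω - c|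
  exact le_trans (by linarith) (le_abs_self _)

lemma IsRate.tendsto_lower {c d : ℝ} (hc : IsRate P X Y L α c) (hd : d < c) :
    Tendsto (fun n : ℕ => P {ω | logPredictive X Y L α n ω < d}) atTop (𝓝 0) := by
  refine tendsto_measure_zero_of_subset
    (tendstoInMeasure_iff_dist.1 hc (c - d) (by linarith)) fun n _ ω hω => ?_
  have h : logPredictive X Y L α n ω < d := hω
  change c - d ≤ |logPredictive X Y L α n ω - c|
  exact le_trans (by linarith) (neg_le_abs _)

lemma IsRate.mem_Icc [IsProbabilityMeasure P] {c : ℝ} (hc : IsRate P X Y L α c)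
    (h₂ : Tendsto (fun n : ℕ => P {ω | b₂ < logPredictive X Y L α n ω}) atTop (𝓝 0))
    (h₁ : Tendsto (fun n : ℕ => P {ω | logPredictive X Y L α n ω < b₁}) atTop (𝓝 0)) :
    c ∈ Set.Icc b₁ b₂ :=
  ⟨le_of_forall_gt_imp_ge_of_dense fun _ hd => le_of_tendsto_upper_lower (hc.tendsto_upper hd) h₁,
    le_of_forall_lt_imp_le_of_dense fun _ hd => le_of_tendsto_upper_lower h₂ (hc.tendsto_lower hd)⟩

end Rate

lemma tendsto_of_forall_eventually_mem_Icc {g : ℝ → ℝ} {b : ℝ}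
    (h : ∀ η : ℝ, 0 < η → ∃ a, 0 < a ∧ ∀ α, a ≤ α → g α ∈ Set.Icc (b - η) (b + η)) :
    Tendsto g atTop (𝓝 b) := by
  refine Metric.tendsto_atTop.2 fun η hη => ?_
  obtain ⟨a, -, ha⟩ := h (η / 2) (by positivity)
  refine ⟨a, fun α hα => ?_⟩
  obtain ⟨h1, h2⟩ := ha α hα
  rw [Real.dist_eq, abs_lt]
  constructor <;> linarith

end BinaryRegression

theorem lemma12 :
    -- the uniform bounds, with `a` in the role of `α_δ`
    (∀ δ : ℝ, 0 < δ → ∃ a : ℝ, 0 < a ∧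
      ∀ (Ω : Type v) [MeasurableSpace Ω] (P : Measure Ω) [IsProbabilityMeasure P]
        (X : ℕ → Ω → I), IsUniformSample P X →
        (∀ L : ℝ≥0 → Ω → ℕ, IsPoissonProcess P L →
          IndepFun (fun ω i => X i ω) (fun ω t => L t ω) P →
          Tendsto (fun n : ℕ => P {ω | (2 : ℝ) ^ (-(n : ℝ) + n * δ) ≤
            (⨆ α : Set.Ici a, ⨆ y : Fin (L n ω) → Bool,
              Zstar ((α : ℝ) * n) (sample X (L n ω) ω) y)}) atTop (𝓝 0) ∧
          Tendsto (fun n : ℕ => P {ω |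
            (⨅ α : Set.Ici a, ⨅ y : Fin (L n ω) → Bool,
              Zstar ((α : ℝ) * n) (sample X (L n ω) ω) y)
                ≤ (2 : ℝ) ^ (-(n : ℝ) - n * δ)}) atTop (𝓝 0)) ∧
        Tendsto (fun n : ℕ => P {ω | (2 : ℝ) ^ (-(n : ℝ) + n * δ) ≤
          (⨆ m : {m : ℕ // a * n ≤ m}, ⨆ y : Fin n → Bool, Z m (sample X n ω) y)})
            atTop (𝓝 0) ∧
        Tendsto (fun n : ℕ => P {ω |
          (⨅ m : {m : ℕ // a * n ≤ m}, ⨅ y : Fin n → Bool, Z m (sample X n ω) y)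
            ≤ (2 : ℝ) ^ (-(n : ℝ) - n * δ)}) atTop (𝓝 0)) ∧
    -- the behaviour of the rate function at infinity
    (∀ f : I → I, Measurable f →
      ∀ (Ω : Type v) [MeasurableSpace Ω] (P : Measure Ω) [IsProbabilityMeasure P]
        (X : ℕ → Ω → I) (Y : ℕ → Ω → Bool) (L : ℝ≥0 → Ω → ℕ),
        IsDataStream f P X Y → IsPoissonProcess P L →
        IndepFun (fun ω i => (X i ω, Y i ω)) (fun ω t => L t ω) P →
        Tendsto (upperRate P X Y L) atTop (𝓝 (-Real.log 2)) ∧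
        Tendsto (lowerRate P X Y L) atTop (𝓝 (-Real.log 2)) ∧
        ∀ ψ : ℝ → ℝ, (∀ α : ℝ, 0 < α → IsRate P X Y L α (ψ α)) →
          Tendsto ψ atTop (𝓝 (-Real.log 2))) := by
  refine ⟨fun δ hδ => ?_, fun f _ Ω _ P _ X Y L hXY hL _ => ?_⟩
  · obtain ⟨a, ha0, ha⟩ := exists_uniform_bounds.{v} hδ
    refine ⟨a, ha0, fun Ω _ P _ X hX => ⟨fun L hL _ => ?_, (ha Ω P X hX).2⟩⟩
    exact ⟨((ha Ω P X hX).1 L hL).1, ((ha Ω P X hX).1 L hL).2.1⟩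
  · have hX := hXY.isUniformSample
    refine ⟨tendsto_of_forall_eventually_mem_Icc fun η hη => ?_,
      tendsto_of_forall_eventually_mem_Icc fun η hη => ?_,
      fun ψ hψ => tendsto_of_forall_eventually_mem_Icc fun η hη => ?_⟩
    all_goals
      obtain ⟨a, ha0, ha⟩ := exists_logPredictive_bounds.{v} hη
      refine ⟨a, ha0, fun α hα => ?_⟩
      obtain ⟨h₂, h₁⟩ := ha Ω P X Y L hX hL α hα
    · exact upperRate_mem_Icc h₂ h₁
    · exact lowerRate_mem_Icc h₂ h₁
    · exact (hψ α (ha0.trans_le hα)).mem_Icc h₂ h₁
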